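/- Let $A\in\mathbb{R}^{n\times n}$, $B\in\mathbb{R}^{n\times m}$, and let $F\in\mathbb{R}^{r\times n}$ have full row rank, $\operatorname{rank}F=r$. Let $F^-\in\mathbb{R}^{n\times r}$ be any generalised inverse of $F$, i.e. any matrix with $FF^-F=F$. Assume $$\operatorname{rank}\begin{pmatrix}FA\\F\end{pmatrix}=\operatorname{rank}F\qquad\text{and}\qquad \operatorname{rank}\begin{pmatrix}sF-FA & FB\end{pmatrix}=\operatorname{rank}F\quad\text{for all } s\in\mathbb{C}.$$ Let $\Lambda=\{\lambda_1,\dots,\lambda_r\}$ be any multiset of $r$ complex numbers that is invariant under complex conjugation. Then there is a real gain matrix $Z\in\mathbb{R}^{m\times r}$ such that the $r$ eigenvalues of $FAF^- - FBZ$, counted with algebraic multiplicity, are exactly $\Lambda$. Moreover, for every such $Z$ the elements of $\Lambda$ are, counted with algebraic multiplicity, among the eigenvalues of $A-BZF$, which is the system matrix of $\dot x(t)=Ax(t)+Bu(t)$ closed with the control law $u(t)=-ZFx(t)$. -/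

import Mathlib

/-- `G` is a generalised inverse of `F`: the single condition `F G F = F`. -/
def IsGenInverse {r n : ℕ} (F : Matrix (Fin r) (Fin n) ℝ) (G : Matrix (Fin n) (Fin r) ℝ) : Prop :=
  F * G * F = F

/-- The complexification of a real matrix. -/
noncomputable def toComplex {k l : ℕ} (X : Matrix (Fin k) (Fin l) ℝ) :
    Matrix (Fin k) (Fin l) ℂ :=
  X.map Complex.ofReal

/-- The complex eigenvalues of a real square matrix of size `k`, counted with algebraic
multiplicity (so there are exactly `k` of them). -/
noncomputable def eigs {k : ℕ} (X : Matrix (Fin k) (Fin k) ℝ) : Multiset ℂ :=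
  (toComplex X).charpoly.roots

/-! Full row rank turns `F * G * F = F` into `F * G = 1`. The first rank condition says `ker F ⊆ ker
(F * A)`, so `F * A = N * F` with `N = F * A * G`. Thus `F` intertwines `A - B * Z * F` with `N - F
* B * Z`, and the characteristic polynomial of the latter divides that of the former. The second
rank condition is the Hautus test for the pair `(N, F * B)`, which is therefore controllable, and
pole placement gives `Z`. Heymann's lemma reduces pole placement to one input `b`. There the
characteristic polynomial is affine in the feedback row `f`; cyclicity of `b` makes its linear part
injective, hence bijective by dimension. -/

open Matrix Polynomial

section Intertwining

variable {R : Type*} [CommRing R] {m n : Type*} [Fintype m] [DecidableEq m] [Fintype n]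
  [DecidableEq n]

/-- `G * F` is a projection, and `X - M` factors so that the first factor, by Sylvester's identity
`det (1 + PQ) = det (1 + QP)`, has determinant `det (X - N)`. -/
theorem charpoly_dvd_charpoly_of_intertwine {F : Matrix m n R} {G : Matrix n m R}
    {M : Matrix n n R} {N : Matrix m m R} (hFG : F * G = 1) (h : F * M = N * F) :
    N.charpoly ∣ M.charpoly := by
  have hFG' : F.map C * G.map C = (1 : Matrix m m R[X]) := by
    rw [← Matrix.map_mul, hFG]; simp
  have hX : F.map C * M.charmatrix = N.charmatrix * F.map C := by
    simp only [charmatrix, Matrix.mul_sub, Matrix.sub_mul, RingHom.mapMatrix_apply]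
    rw [← Matrix.map_mul, h, Matrix.map_mul]
    congr 1
    refine Matrix.ext fun i j => ?_
    rw [scalar_apply, scalar_apply, mul_diagonal, diagonal_mul, mul_comm]
  have key : M.charmatrix = (1 + G.map C * ((N.charmatrix - 1) * F.map C)) *
      (G.map C * F.map C + (1 - G.map C * F.map C) * M.charmatrix) := by
    have h1 : F.map C * (G.map C * F.map C + (1 - G.map C * F.map C) * M.charmatrix) =
        F.map C := by
      rw [Matrix.mul_add, ← Matrix.mul_assoc, hFG', ← Matrix.mul_assoc, Matrix.mul_sub,
        ← Matrix.mul_assoc, hFG']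
      simp
    rw [Matrix.add_mul, Matrix.mul_assoc, Matrix.mul_assoc, h1, Matrix.sub_mul N.charmatrix, ← hX,
      Matrix.one_mul, Matrix.one_mul, Matrix.mul_sub, Matrix.sub_mul, Matrix.one_mul,
      ← Matrix.mul_assoc]
    abel
  rw [Matrix.charpoly, Matrix.charpoly, key, det_mul, det_one_add_mul_comm, Matrix.mul_assoc,
    hFG', mul_one, add_sub_cancel]
  exact dvd_mul_right _ _

end Intertwining

section RankOne

variable {n : Type*} [Fintype n] [DecidableEq n]

theorem det_add_vecMulVec_of_field {K : Type*} [Field K] {A : Matrix n n K} (hA : A.det ≠ 0)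
    (u v : n → K) : (A + vecMulVec u v).det = A.det + v ⬝ᵥ (A.adjugate *ᵥ u) := by
  rw [vecMulVec_eq Unit, det_add_replicateCol_mul_replicateRow hA.isUnit, det_unique (n := Unit),
    Matrix.mul_assoc, ← replicateCol_mulVec]
  simp only [Matrix.add_apply, one_apply_eq, replicateRow_mul_replicateCol_apply]
  rw [inv_def, smul_mulVec, dotProduct_smul, Ring.inverse_eq_inv', smul_eq_mul]
  field_simp

/-- The adjugate form is needed because `X - A` is invertible only over the fraction field of
`K[X]`. -/
theorem det_add_vecMulVec {R : Type*} [CommRing R] [IsDomain R] {A : Matrix n n R}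
    (hA : A.det ≠ 0) (u v : n → R) :
    (A + vecMulVec u v).det = A.det + v ⬝ᵥ (A.adjugate *ᵥ u) := by
  let φ := algebraMap R (FractionRing R)
  have hφ : Function.Injective φ := IsFractionRing.injective R (FractionRing R)
  have hA' : (φ.mapMatrix A).det ≠ 0 := by
    rw [← RingHom.map_det]
    exact (map_ne_zero_iff φ hφ).2 hA
  apply hφ
  have := det_add_vecMulVec_of_field hA' (φ ∘ u) (φ ∘ v)
  rw [← RingHom.map_det, ← RingHom.map_adjugate] at this
  rw [RingHom.map_det, map_add φ, RingHom.map_dotProduct,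
    show φ ∘ (A.adjugate *ᵥ u) = _ from funext fun i => RingHom.map_mulVec φ A.adjugate u i]
  refine Eq.trans ?_ this
  congr 1
  ext i j
  simp [vecMulVec_apply]

end RankOne

/-! ### Single-input pole placement. -/

section SingleInput

variable {K : Type*} [Field K] {n : Type*} [Fintype n] [DecidableEq n]

/-- The resolvent vector `adj (X - A) b`. -/
noncomputable def resolventVec (A : Matrix n n K) (b : n → K) : n → K[X] :=
  A.charmatrix.adjugate *ᵥ (C ∘ b)

theorem charpoly_sub_vecMulVec (A : Matrix n n K) (b f : n → K) :
    (A - vecMulVec b f).charpoly = A.charpoly + (C ∘ f) ⬝ᵥ resolventVec A b := by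
  rw [resolventVec, Matrix.charpoly, Matrix.charpoly,
    ← det_add_vecMulVec (A.charpoly_monic.ne_zero)]
  congr 1
  refine Matrix.ext fun i j => ?_
  simp only [charmatrix_apply, Matrix.sub_apply, Matrix.add_apply, vecMulVec_apply, map_sub, map_mul,
    Function.comp]
  ring

theorem degree_dotProduct_resolventVec_lt (A : Matrix n n K) (b f : n → K) :
    ((C ∘ f) ⬝ᵥ resolventVec A b).degree < Fintype.card n := by
  rw [← add_sub_cancel_left A.charpoly ((C ∘ f) ⬝ᵥ resolventVec A b), ← charpoly_sub_vecMulVec,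
    ← charpoly_degree_eq_dim (A - vecMulVec b f)]
  exact degree_sub_lt_left (by rw [charpoly_degree_eq_dim, charpoly_degree_eq_dim])
    (charpoly_monic _).ne_zero
    (by rw [(charpoly_monic _).leadingCoeff, (charpoly_monic _).leadingCoeff])

theorem charmatrix_mulVec_resolventVec (A : Matrix n n K) (b : n → K) :
    A.charmatrix *ᵥ resolventVec A b = A.charpoly • (C ∘ b) := by
  rw [resolventVec, mulVec_mulVec, mul_adjugate, smul_mulVec, one_mulVec, Matrix.charpoly]

/-- Pairing `f` with `(X - A) adj(X - A) b = χ b` gives `(f A) · adj(X - A) b = -χ (f · b)`. The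
left side has degree below that of `χ`, so both sides vanish. -/
theorem dotProduct_resolventVec_step (A : Matrix n n K) (b f : n → K)
    (h : (C ∘ f) ⬝ᵥ resolventVec A b = 0) :
    f ⬝ᵥ b = 0 ∧ (C ∘ (f ᵥ* A)) ⬝ᵥ resolventVec A b = 0 := by
  have h1 : (C ∘ (f ᵥ* A)) ⬝ᵥ resolventVec A b = - (A.charpoly * C (f ⬝ᵥ b)) := by
    have h2 := congrArg ((C ∘ f) ⬝ᵥ ·) (charmatrix_mulVec_resolventVec A b)
    simp only [charmatrix, sub_mulVec, dotProduct_sub, dotProduct_smul] at h2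
    rw [← RingHom.map_dotProduct, dotProduct_mulVec _ (C.mapMatrix A)] at h2
    have h3 : (C ∘ f) ᵥ* (C.mapMatrix A) = C ∘ (f ᵥ* A) := by
      ext1 i
      exact (RingHom.map_vecMul C A f i).symm
    have h4 : (C ∘ f) ⬝ᵥ ((Matrix.scalar n (X : K[X])) *ᵥ resolventVec A b) = 0 := by
      rw [scalar_apply, diagonal_const_mulVec, dotProduct_smul, h, smul_zero]
    rw [h3, h4, zero_sub, smul_eq_mul] at h2
    rw [← h2, neg_neg]
  have h0 : f ⬝ᵥ b = 0 := by
    by_contra hne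
    have hd := degree_dotProduct_resolventVec_lt A b (f ᵥ* A)
    rw [h1, degree_neg, degree_mul, degree_C hne, add_zero, charpoly_degree_eq_dim] at hd
    exact lt_irrefl _ hd
  exact ⟨h0, by rw [h1, h0]; simp⟩

/-- Pole placement for a single input: if `b` is a cyclic vector for `A`, then every monic
polynomial of the right degree is the characteristic polynomial of some `A - b fᵀ`. -/
theorem exists_charpoly_sub_vecMulVec_eq (A : Matrix n n K) (b : n → K)
    (hcyc : ∀ W : Submodule K (n → K), b ∈ W → (∀ x ∈ W, A *ᵥ x ∈ W) → W = ⊤)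
    (p : K[X]) (hp : p.Monic) (hdeg : p.natDegree = Fintype.card n) :
    ∃ f : n → K, (A - vecMulVec b f).charpoly = p := by
  let Φ : (n → K) →ₗ[K] degreeLT K (Fintype.card n) :=
    { toFun := fun f => ⟨(C ∘ f) ⬝ᵥ resolventVec A b,
        mem_degreeLT.2 (degree_dotProduct_resolventVec_lt A b f)⟩
      map_add' := fun f g => by
        ext1
        simp [dotProduct, add_mul, Finset.sum_add_distrib]
      map_smul' := fun c f => by
        ext1
        simp [dotProduct, Finset.smul_sum, smul_eq_C_mul, mul_assoc] }
  have hinj : Function.Injective Φ := by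
    rw [← LinearMap.ker_eq_bot, LinearMap.ker_eq_bot']
    intro f hf
    have hf0 : (C ∘ f) ⬝ᵥ resolventVec A b = 0 := congrArg Subtype.val hf
    -- The common kernel of all rows annihilating the resolvent vector contains `b` and is
    -- `A`-invariant, so by cyclicity it is everything and such rows are zero.
    let W : Submodule K (n → K) :=
      { carrier := {x | ∀ g : n → K, (C ∘ g) ⬝ᵥ resolventVec A b = 0 → g ⬝ᵥ x = 0}
        add_mem' := fun hx hy g hg => by rw [dotProduct_add, hx g hg, hy g hg, add_zero]
        zero_mem' := fun g _ => dotProduct_zero g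
        smul_mem' := fun c x hx g hg => by rw [dotProduct_smul, hx g hg, smul_zero] }
    have hW : W = ⊤ := by
      refine hcyc W (fun g hg => (dotProduct_resolventVec_step A b g hg).1) fun x hx g hg => ?_
      rw [dotProduct_mulVec]
      exact hx _ (dotProduct_resolventVec_step A b g hg).2
    refine dotProduct_eq_zero _ fun x => ?_
    have hx : x ∈ W := hW ▸ Submodule.mem_top
    exact hx f hf0
  have hfin : Module.finrank K (n → K) = Module.finrank K (degreeLT K (Fintype.card n)) := by
    rw [(degreeLTEquiv K (Fintype.card n)).finrank_eq]
    simp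
  have : FiniteDimensional K (degreeLT K (Fintype.card n)) :=
    (degreeLTEquiv K (Fintype.card n)).symm.finiteDimensional
  have hsurj := (LinearMap.injective_iff_surjective_of_finrank_eq_finrank hfin).1 hinj
  have hmem : p - A.charpoly ∈ degreeLT K (Fintype.card n) := by
    rw [mem_degreeLT]
    have hpd : p.degree = Fintype.card n := by rw [degree_eq_natDegree hp.ne_zero, hdeg]
    rw [← hpd]
    exact degree_sub_lt_left (by rw [hpd, charpoly_degree_eq_dim]) hp.ne_zero
      (by rw [hp.leadingCoeff, (charpoly_monic _).leadingCoeff])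
  obtain ⟨f, hf⟩ := hsurj ⟨_, hmem⟩
  refine ⟨f, ?_⟩
  have hf' : (C ∘ f) ⬝ᵥ resolventVec A b = p - A.charpoly := congrArg Subtype.val hf
  rw [charpoly_sub_vecMulVec, hf', add_sub_cancel]

end SingleInput

/-! ### Reduction to one input. -/

section Heymann

variable {K V U : Type*} [Field K] [AddCommGroup V] [Module K V] [AddCommGroup U] [Module K U]

theorem iterate_congr_of_forall_lt {V : Type*} {f g : V → V} {b : V} {k : ℕ}
    (h : ∀ i < k, f (g^[i] b) = g (g^[i] b)) : ∀ i ≤ k, f^[i] b = g^[i] b := by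
  intro i
  induction i with
  | zero => intro _; rfl
  | succ i ih =>
    intro hi
    rw [Function.iterate_succ_apply', Function.iterate_succ_apply', ih (by omega), h i (by omega)]

/-- One step of Heymann's construction. -/
theorem exists_feedback_linearIndependent_succ (A : V →ₗ[K] V) (B : U →ₗ[K] V)
    (hctrl : ∀ W : Submodule K V, (∀ u, B u ∈ W) → (∀ x ∈ W, A x ∈ W) → W = ⊤)
    (b : V) (k : ℕ) (L : V →ₗ[K] U)
    (hli : LinearIndependent K fun i : Fin (k + 1) => (A + B ∘ₗ L)^[i] b)
    (hne : Submodule.span K (Set.range fun i : Fin (k + 1) => (A + B ∘ₗ L)^[i] b) ≠ ⊤) :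
    ∃ L' : V →ₗ[K] U,
      LinearIndependent K fun i : Fin (k + 2) => (A + B ∘ₗ L')^[i] b := by
  set T := A + B ∘ₗ L with hT
  set S := Submodule.span K (Set.range fun i : Fin (k + 1) => T^[i] b) with hS
  have hmem : ∀ i < k + 1, T^[i] b ∈ S := fun i hi => Submodule.subset_span ⟨⟨i, hi⟩, rfl⟩
  -- Keep the existing chain and only redirect the image of its last vector out of the span `S`.
  suffices h : ∃ L' : V →ₗ[K] U, (∀ i < k, (A + B ∘ₗ L') (T^[i] b) = T (T^[i] b)) ∧
      (A + B ∘ₗ L') (T^[k] b) ∉ S by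
    obtain ⟨L', h1, h2⟩ := h
    have h3 := iterate_congr_of_forall_lt (f := A + B ∘ₗ L') h1
    refine ⟨L', ?_⟩
    rw [linearIndependent_finSucc']
    have hinit : (Fin.init fun i : Fin (k + 2) => (A + B ∘ₗ L')^[i] b) =
        fun i : Fin (k + 1) => T^[i] b := by
      ext i
      exact h3 i (by omega)
    rw [hinit]
    refine ⟨hli, ?_⟩
    simp only [Fin.val_last]
    rw [Function.iterate_succ_apply', h3 k le_rfl]
    exact h2
  by_cases hk : T (T^[k] b) ∈ S
  · have hinv : ∀ x ∈ S, T x ∈ S := by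
      intro x hx
      induction hx using Submodule.span_induction with
      | mem x hx =>
        obtain ⟨i, rfl⟩ := hx
        rcases Nat.lt_or_ge i k with hi | hi
        · have := hmem (i + 1) (by omega)
          rwa [Function.iterate_succ_apply'] at this
        · have : (i : ℕ) = k := by omega
          simpa only [this] using hk
      | zero => simp
      | add x y _ _ hx hy => rw [map_add]; exact S.add_mem hx hy
      | smul c x _ hx => rw [map_smul]; exact S.smul_mem c hx
    -- `S` is `T`-invariant; if it also contained the range of `B` it would be `A`-invariant, hence
    -- everything.
    obtain ⟨u, hu⟩ : ∃ u, B u ∉ S := by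
      by_contra! hall
      refine hne (hctrl S hall fun x hx => ?_)
      have : A x = T x - B (L x) := by simp [hT]
      rw [this]
      exact S.sub_mem (hinv x hx) (hall _)
    have hnot : T^[k] b ∉ Submodule.span K (Set.range fun i : Fin k => T^[i] b) := by
      have := (linearIndependent_finSucc'.1 hli).2
      exact this
    -- Adding the rank-one feedback `φ(·) u` leaves the earlier chain steps unchanged and pushes the
    -- last one along `B u`.
    obtain ⟨φ, hφ, hker⟩ := Submodule.exists_le_ker_of_notMem hnot
    have hT' : ∀ x, (A + B ∘ₗ (L + φ.smulRight u)) x = T x + φ x • B u := by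
      intro x
      simp [hT, add_assoc]
    refine ⟨L + φ.smulRight u, fun i hi => ?_, ?_⟩
    · have : φ (T^[i] b) = 0 := hker (Submodule.subset_span ⟨⟨i, hi⟩, rfl⟩)
      rw [hT', this, zero_smul, add_zero]
    · rw [hT', S.add_mem_iff_right hk, S.smul_mem_iff hφ]
      exact hu
  · exact ⟨L, fun _ _ => rfl, hk⟩

/-- **Heymann's lemma**: a controllable pair `(A, B)` can be made controllable from a single
input vector in the range of `B` by a state feedback. -/
theorem exists_feedback_cyclic [FiniteDimensional K V] (A : V →ₗ[K] V) (B : U →ₗ[K] V)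
    (hctrl : ∀ W : Submodule K V, (∀ u, B u ∈ W) → (∀ x ∈ W, A x ∈ W) → W = ⊤) :
    ∃ (u : U) (L : V →ₗ[K] U), ∀ W : Submodule K V,
      B u ∈ W → (∀ x ∈ W, (A + B ∘ₗ L) x ∈ W) → W = ⊤ := by
  by_cases hB : ∀ u, B u = 0
  · have hbot : (⊥ : Submodule K V) = ⊤ := hctrl ⊥ (by simpa using hB) (by simp)
    exact ⟨0, 0, fun W _ _ => top_le_iff.1 (hbot ▸ bot_le)⟩
  push Not at hB
  obtain ⟨u, hu⟩ := hB
  have hpos : 0 < Module.finrank K V := Module.finrank_pos_iff_exists_ne_zero.2 ⟨_, hu⟩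
  have main : ∀ k < Module.finrank K V, ∃ L : V →ₗ[K] U,
      LinearIndependent K fun i : Fin (k + 1) => (A + B ∘ₗ L)^[i] (B u) := by
    intro k
    induction k with
    | zero =>
      intro _
      refine ⟨0, ?_⟩
      refine (linearIndependent_unique_iff (ι := Fin 1)).2 ?_
      simpa using hu
    | succ k ih =>
      intro hk
      obtain ⟨L, hL⟩ := ih (by omega)
      refine exists_feedback_linearIndependent_succ A B hctrl (B u) k L hL fun htop => ?_
      have := finrank_span_eq_card hL
      rw [htop, finrank_top, Fintype.card_fin] at this
      omega
  obtain ⟨L, hL⟩ := main (Module.finrank K V - 1) (by omega)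
  refine ⟨u, L, fun W hW hinv => ?_⟩
  rw [← top_le_iff, ← hL.span_eq_top_of_card_eq_finrank' (by rw [Fintype.card_fin]; omega),
    Submodule.span_le]
  rintro _ ⟨i, rfl⟩
  change (A + B ∘ₗ L)^[i] (B u) ∈ W
  generalize (i : ℕ) = j
  induction j with
  | zero => exact hW
  | succ j ih =>
    rw [Function.iterate_succ_apply']
    exact hinv _ ih

end Heymann

/-- Pole placement by state feedback for a controllable pair over a field. -/
theorem exists_charpoly_sub_mul_eq {K n m : Type*} [Field K] [Fintype n] [DecidableEq n]
    [Fintype m] [DecidableEq m] (A : Matrix n n K) (B : Matrix n m K)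
    (hctrl : ∀ W : Submodule K (n → K), (∀ u, B *ᵥ u ∈ W) → (∀ x ∈ W, A *ᵥ x ∈ W) → W = ⊤)
    (p : K[X]) (hp : p.Monic) (hdeg : p.natDegree = Fintype.card n) :
    ∃ Z : Matrix m n K, (A - B * Z).charpoly = p := by
  obtain ⟨u, L, hL⟩ := exists_feedback_cyclic A.mulVecLin B.mulVecLin hctrl
  obtain ⟨f, hf⟩ := exists_charpoly_sub_vecMulVec_eq (A + B * LinearMap.toMatrix' L) (B *ᵥ u)
    (fun W hu hinv => hL W hu fun x hx => by
      simpa [add_mulVec, ← mulVec_mulVec, LinearMap.toMatrix'_mulVec] using hinv x hx) p hp hdeg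
  -- With this gain `A - B * Z` is `(A + B L) - (B u) fᵀ`.
  refine ⟨vecMulVec u f - LinearMap.toMatrix' L, ?_⟩
  rw [← hf, Matrix.mul_sub, mul_vecMulVec]
  congr 1
  abel

/-! ### Passing between `ℝ` and `ℂ`. -/

section RealComplex

theorem exists_real_poly_of_conj_invariant (Λ : Multiset ℂ)
    (hΛ : Λ.map (starRingEnd ℂ) = Λ) :
    ∃ p : ℝ[X], p.Monic ∧ p.natDegree = Multiset.card Λ ∧
      (p.map Complex.ofRealHom).roots = Λ := by
  set q : ℂ[X] := (Λ.map fun a => X - C a).prod with hq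
  have hmon : q.Monic := monic_multiset_prod_of_monic _ _ fun a _ => monic_X_sub_C a
  have hconj : q.map (starRingEnd ℂ) = q := by
    conv_rhs => rw [hq, ← hΛ]
    rw [hq, Polynomial.map_multiset_prod, Multiset.map_map, Multiset.map_map]
    simp
  have hlift : q ∈ lifts Complex.ofRealHom := by
    rw [lifts_iff_coeff_lifts]
    intro i
    have : (starRingEnd ℂ) (q.coeff i) = q.coeff i := by rw [← coeff_map, hconj]
    obtain ⟨r, hr⟩ := Complex.conj_eq_iff_real.1 this
    exact ⟨r, hr.symm⟩
  obtain ⟨p, hpq, hdeg, hpm⟩ := lifts_and_natDegree_eq_and_monic hlift hmon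
  exact ⟨p, hpm, by rw [hdeg, hq, natDegree_multiset_prod_X_sub_C_eq_card],
    by rw [hpq, hq, roots_multiset_prod_X_sub_C]⟩

theorem ofReal_comp_mulVec {n k : Type*} [Fintype k] (M : Matrix n k ℝ) (x : k → ℝ) :
    Complex.ofReal ∘ (M *ᵥ x) = M.map Complex.ofReal *ᵥ (Complex.ofReal ∘ x) :=
  funext fun i => RingHom.map_mulVec Complex.ofRealHom M x i

/-- The Popov–Belevitch–Hautus test over `ℂ` implies controllability over `ℝ`. -/
theorem eq_top_of_hautus {n m : Type*} [Fintype n] [DecidableEq n] [Fintype m]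
    (A : Matrix n n ℝ) (B : Matrix n m ℝ)
    (h : ∀ (s : ℂ) (v : n → ℂ), v ᵥ* A.map Complex.ofReal = s • v →
      v ᵥ* B.map Complex.ofReal = 0 → v = 0)
    (W : Submodule ℝ (n → ℝ)) (hB : ∀ u, B *ᵥ u ∈ W) (hA : ∀ x ∈ W, A *ᵥ x ∈ W) : W = ⊤ := by
  classical
  -- The complex annihilator of `W` is stable under `v ↦ v ᵥ* A`. If nonzero, it contains a left
  -- eigenvector of `A`, which also kills `B`, against the Hautus condition.
  let S : Submodule ℂ (n → ℂ) :=
    { carrier := {v | ∀ w ∈ W, v ⬝ᵥ (Complex.ofReal ∘ w) = 0}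
      add_mem' := fun hx hy w hw => by rw [add_dotProduct, hx w hw, hy w hw, add_zero]
      zero_mem' := fun w _ => zero_dotProduct _
      smul_mem' := fun c x hx w hw => by rw [smul_dotProduct, hx w hw, smul_zero] }
  have hSinv : ∀ v ∈ S, (A.map Complex.ofReal).vecMulLinear v ∈ S := by
    intro v hv w hw
    rw [vecMulLinear_apply, ← dotProduct_mulVec, ← ofReal_comp_mulVec]
    exact hv _ (hA w hw)
  have hSbot : S = ⊥ := by
    by_contra hne
    have : Nontrivial S := Submodule.nontrivial_iff_ne_bot.2 hne
    obtain ⟨s, hs⟩ := Module.End.exists_eigenvalue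
      ((A.map Complex.ofReal).vecMulLinear.restrict hSinv)
    obtain ⟨v, hv⟩ := hs.exists_hasEigenvector
    refine hv.2 (Subtype.ext (h s v (congrArg Subtype.val hv.apply_eq_smul) ?_))
    refine dotProduct_eq_zero _ fun x => ?_
    have hcol : ∀ j, (v : n → ℂ) ⬝ᵥ ((B.map Complex.ofReal) *ᵥ Pi.single j 1) = 0 := by
      intro j
      have := v.2 _ (hB (Pi.single j 1))
      rw [ofReal_comp_mulVec] at this
      convert this using 3
      ext i
      by_cases hij : i = j
      · subst hij; simp
      · simp [hij]
    have hz : (v : n → ℂ) ᵥ* B.map Complex.ofReal = 0 := by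
      ext j
      have := hcol j
      rwa [dotProduct_mulVec, dotProduct_single_one] at this
    rw [hz, zero_dotProduct]
  by_contra hW
  -- A nonzero real functional vanishing on a proper `W` would complexify to a nonzero element of
  -- `S`.
  obtain ⟨φ, hφ, hker⟩ := Submodule.exists_le_ker_of_lt_top W (lt_top_iff_ne_top.2 hW)
  have hφx : ∀ x, φ x = (fun i => φ (Pi.single i 1)) ⬝ᵥ x := by
    intro x
    conv_lhs => rw [pi_eq_sum_univ' x]
    simp [dotProduct, map_sum, mul_comm]
  have hmem : (fun i => (φ (Pi.single i 1) : ℂ)) ∈ S := by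
    intro w hw
    have hw0 : φ w = 0 := hker hw
    rw [hφx] at hw0
    have := congrArg Complex.ofReal hw0
    simpa [dotProduct] using this
  rw [hSbot, Submodule.mem_bot] at hmem
  apply hφ
  ext i
  simpa using congrFun hmem i

end RealComplex

section RowRank

variable {K : Type*} [Field K] {m n l : Type*} [Fintype n]

theorem eq_zero_of_vecMul_eq_zero_of_rank_eq_card [Fintype m] {M : Matrix m n K}
    (hM : M.rank = Fintype.card m) {v : m → K} (hv : v ᵥ* M = 0) : v = 0 := by
  have hli : LinearIndependent K M.row := by
    rw [linearIndependent_iff_card_eq_finrank_span, ← hM, M.rank_eq_finrank_span_row]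
    rfl
  exact vecMul_injective_iff.2 hli (by simpa using hv)

/-- Stacking rows can only shrink the kernel; equal rank means equal nullity, so the kernel does not
change. -/
theorem mulVec_eq_zero_of_rank_fromRows_eq {M : Matrix l n K} {F : Matrix m n K}
    (h : (Matrix.fromRows M F).rank = F.rank) {x : n → K} (hx : F *ᵥ x = 0) : M *ᵥ x = 0 := by
  have hle : LinearMap.ker (Matrix.fromRows M F).mulVecLin ≤ LinearMap.ker F.mulVecLin := by
    intro y hy
    rw [LinearMap.mem_ker, mulVecLin_apply, fromRows_mulVec] at hy
    ext i
    exact congrFun hy (Sum.inr i)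
  have heq := Submodule.eq_of_le_of_finrank_eq hle (by
    have h1 := (Matrix.fromRows M F).mulVecLin.finrank_range_add_finrank_ker
    have h2 := F.mulVecLin.finrank_range_add_finrank_ker
    rw [Matrix.rank, Matrix.rank] at h
    omega)
  have hx' : x ∈ LinearMap.ker (Matrix.fromRows M F).mulVecLin := by
    rw [heq]
    exact hx
  rw [LinearMap.mem_ker, mulVecLin_apply, fromRows_mulVec] at hx'
  ext i
  exact congrFun hx' (Sum.inl i)

end RowRank

theorem toComplex_mul {k l p : ℕ} (X : Matrix (Fin k) (Fin l) ℝ) (Y : Matrix (Fin l) (Fin p) ℝ) :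
    toComplex (X * Y) = toComplex X * toComplex Y :=
  Matrix.map_mul (f := Complex.ofRealHom)

theorem eigs_eq_roots_map_charpoly {k : ℕ} (X : Matrix (Fin k) (Fin k) ℝ) :
    eigs X = (X.charpoly.map Complex.ofRealHom).roots := by
  rw [← charpoly_map]
  rfl

theorem theorem4 {n m r : ℕ}
    (A : Matrix (Fin n) (Fin n) ℝ) (B : Matrix (Fin n) (Fin m) ℝ)
    (F : Matrix (Fin r) (Fin n) ℝ)
    (hF : F.rank = r)
    (h_rows : (Matrix.fromRows (F * A) F).rank = F.rank)
    (h_pbh : ∀ s : ℂ,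
      (Matrix.fromCols (s • toComplex F - toComplex (F * A)) (toComplex (F * B))).rank = F.rank)
    (G : Matrix (Fin n) (Fin r) ℝ) (hG : IsGenInverse F G)
    (Λ : Multiset ℂ) (hΛ_card : Multiset.card Λ = r)
    (hΛ_conj : Λ.map (starRingEnd ℂ) = Λ) :
    (∃ Z : Matrix (Fin m) (Fin r) ℝ, eigs (F * A * G - F * B * Z) = Λ) ∧
      ∀ Z : Matrix (Fin m) (Fin r) ℝ,
        eigs (F * A * G - F * B * Z) = Λ → Λ ≤ eigs (A - B * Z * F) := by
  have hFG : F * G = 1 := by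
    rw [← sub_eq_zero]
    ext i j
    have hrow : (F * G - 1).row i ᵥ* F = 0 := by
      have h0 : (F * G - 1) * F = 0 := by rw [Matrix.sub_mul, hG, Matrix.one_mul, sub_self]
      exact congrFun h0 i
    exact congrFun
      (eq_zero_of_vecMul_eq_zero_of_rank_eq_card (by rw [hF, Fintype.card_fin]) hrow) j
  have hFA : F * A * G * F = F * A := by
    rw [← sub_eq_zero]
    refine Matrix.ext_of_mulVec_single fun j => ?_
    -- The columns of `G * F - 1` lie in `ker F`, hence in `ker (F * A)`.
    have hker : F *ᵥ (G *ᵥ (F *ᵥ Pi.single j 1) - Pi.single j 1) = 0 := by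
      rw [mulVec_sub, mulVec_mulVec, hFG, one_mulVec, sub_self]
    have := mulVec_eq_zero_of_rank_fromRows_eq h_rows hker
    rw [mulVec_sub, mulVec_mulVec, mulVec_mulVec, ← Matrix.sub_mulVec] at this
    rw [this, zero_mulVec]
  constructor
  · obtain ⟨p, hp, hdeg, hroots⟩ := exists_real_poly_of_conj_invariant Λ hΛ_conj
    obtain ⟨Z, hZ⟩ := exists_charpoly_sub_mul_eq (F * A * G) (F * B)
      (eq_top_of_hautus _ _ fun s v hvA hvB => by
        refine eq_zero_of_vecMul_eq_zero_of_rank_eq_card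
          ((h_pbh s).trans (by rw [hF, Fintype.card_fin])) ?_
        rw [vecMul_fromCols]
        -- Here `s F - F A = (s - N) F`, so a left eigenvector of `N` for `s` annihilates it.
        have h1 : v ᵥ* (s • toComplex F - toComplex (F * A)) = 0 := by
          rw [← hFA, toComplex_mul _ F, vecMul_sub, ← vecMul_vecMul]
          change _ - (v ᵥ* (F * A * G).map Complex.ofReal) ᵥ* _ = 0
          rw [hvA, vecMul_smul, smul_vecMul, sub_self]
        have h2 : v ᵥ* toComplex (F * B) = 0 := hvB
        rw [h1, h2]
        ext i
        cases i <;> rfl) p hp (by rw [hdeg, hΛ_card, Fintype.card_fin])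
    exact ⟨Z, by rw [eigs_eq_roots_map_charpoly, hZ, hroots]⟩
  · rintro Z rfl
    rw [eigs_eq_roots_map_charpoly, eigs_eq_roots_map_charpoly]
    refine Polynomial.roots.le_of_dvd ((charpoly_monic _).map _).ne_zero
      (Polynomial.map_dvd _ (charpoly_dvd_charpoly_of_intertwine hFG ?_))
    rw [Matrix.mul_sub, Matrix.sub_mul, hFA]
    simp only [Matrix.mul_assoc]
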